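/- Let $\mathcal D$ be a small category in which every map factors as a split epimorphism followed by a monomorphism. Suppose that $\mathcal D$ has a terminal object $1$ and that every object of $\mathcal D$ has a point (that is, for every $d$ there is a map $1\to d$). Write $\widehat{\mathcal D}$ for the topos of presheaves of sets on $\mathcal D$. Definitions. A level of $\widehat{\mathcal D}$ is a string of adjoints $l_!\dashv l^*\dashv l_*:\mathcal L\to\widehat{\mathcal D}$ with $l_!$ and $l_*$ fully faithful; levels are ordered, and identified, as subtoposes (via $l_*$). Level $-\infty$ is the level with $\mathcal L$ equivalent to the terminal category. A level $m$ is way-above $l$ if $l\le m$ and $l_!$ factors through $m_*$ (up to isomorphism); the Aufhebung of $l$ is the least level way-above $l$. An idempotent two-sided ideal $\mathcal I$ of $\mathcal D$ induces a level if the sheaves for the topology whose covering sieves on $d$ are those containing all maps of $\mathcal I$ with codomain $d$ form the subtopos of that level; a full subcategory of $\mathcal D$ induces a level through the ideal of the maps that factor through one of its objects. For a level $l$ and a presheaf $X$, let $\ell_X\hookrightarrow X$ be the image of the counit $l_!(l^*X)\to X$. If $l$ is induced by a full subcategory of $\mathcal D$ that is closed under subobjects, then the successor of $l$ is the level induced by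 the full subcategory of those objects $d$ such that, for $X=\mathcal D(-,d)$, every subobject $u$ of $X$ satisfies $u\vee(u\Rightarrow \ell_X)=X$ in the Heyting algebra of subobjects of $X$. A geometric morphism $p$ is pre-cohesive if it is local, hyperconnected and essential, and the leftmost adjoint $p_!$ preserves finite products. Then $\widehat{\mathcal D}$ is pre-cohesive over $\mathbf{Set}$. Moreover, level $-\infty$ of $\widehat{\mathcal D}$ has a successor and an Aufhebung, and both coincide with the subtopos of $\neg\neg$-sheaves of $\widehat{\mathcal D}$, which is in particular a level. -/

import Mathlib

open CategoryTheory CategoryTheory.Limits Opposite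

universe w₁ w₂ v₁ v₂ v u

/-- `F` factors through `G` (up to natural isomorphism). -/
def FactorsThrough {A B E : Type*} [Category* A] [Category* B] [Category* E]
    (F : A ⥤ E) (G : B ⥤ E) : Prop :=
  ∃ H : A ⥤ B, Nonempty (H ⋙ G ≅ F)

/-- A level of `E`: a string of adjoints `l_! ⊣ l^* ⊣ l_* : L ⥤ E` with `l_!` and `l_*` fully
faithful. (The inverse image `l^*` preserves all limits, being a right adjoint, so this is the
same thing as an essential subtopos of `E` when `E` is a topos.) -/
structure Level (E : Type u) [Category.{v} E] where
  /-- The domain of the level. -/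
  L : Type u
  [cat : Category.{v} L]
  /-- The skeletal inclusion `l_!`. -/
  shriek : L ⥤ E
  /-- The inverse image `l^*`. -/
  inverse : E ⥤ L
  /-- The direct image `l_*`. -/
  direct : L ⥤ E
  adjShriek : shriek ⊣ inverse
  adjDirect : inverse ⊣ direct
  shriek_full : shriek.Full
  shriek_faithful : shriek.Faithful
  direct_full : direct.Full
  direct_faithful : direct.Faithful

attribute [instance] Level.cat

namespace Level

section General

variable {E : Type u} [Category.{v} E]

/-- Levels are ordered as subtoposes: `l ≤ m` if `l_*` factors through `m_*`. -/
instance : LE (Level E) := ⟨fun l m => FactorsThrough l.direct m.direct⟩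

/-- `m` is way-above `l` if `l ≤ m` and, moreover, `l_!` factors through `m_*`. -/
def IsWayAbove (m l : Level E) : Prop :=
  l ≤ m ∧ FactorsThrough l.shriek m.direct

/-- `m` is the Aufhebung of `l`: the least level that is way-above `l`
(least with respect to the preorder of levels, so unique as a subtopos). -/
def IsAufhebung (l m : Level E) : Prop :=
  m.IsWayAbove l ∧ ∀ n : Level E, n.IsWayAbove l → m ≤ n

/-- `l` is level `-∞`, the degenerate level: its domain is terminal as a category. -/
def IsMinusInfinity (l : Level E) : Prop :=
  Nonempty (l.L ≌ Discrete PUnit.{1})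

/-- The subtopos of `E` given by the level `l` is the full subcategory of objects with `P`. -/
def IsSubtoposOf (l : Level E) (P : ObjectProperty E) : Prop :=
  ∀ X : E, l.direct.essImage X ↔ P X

end General

end Level

/-- A pre-cohesive geometric morphism `p : E ⟶ S`, as a string of adjoints
`p_! ⊣ p^* ⊣ p_* ⊣ p^!`. (Left exactness of `p^*` is automatic: it is a right adjoint.) -/
structure PreCohesive (E : Type w₁) [Category.{v₁} E] (S : Type w₂) [Category.{v₂} S] where
  /-- The leftmost adjoint `p_!`. -/
  pieces : E ⥤ S
  /-- The inverse image `p^*`. -/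
  discrete : S ⥤ E
  /-- The direct image `p_*`. -/
  points : E ⥤ S
  /-- The rightmost adjoint `p^!`. -/
  codiscrete : S ⥤ E
  /-- `p` is essential. -/
  adjPieces : pieces ⊣ discrete
  adjDiscrete : discrete ⊣ points
  /-- `p` is local. -/
  adjPoints : points ⊣ codiscrete
  codiscrete_full : codiscrete.Full
  codiscrete_faithful : codiscrete.Faithful
  /-- `p` is hyperconnected: `p^*` is fully faithful and its image is closed under subobjects. -/
  discrete_full : discrete.Full
  discrete_faithful : discrete.Faithful
  discrete_closed : discrete.essImage.IsClosedUnderSubobjects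
  /-- `p_!` preserves finite products. -/
  pieces_products : PreservesFiniteProducts pieces

namespace CategoryTheory.Subfunctor

variable {C : Type u} [Category.{v} C] {X : C ⥤ Type w₁}

/-- Heyting implication in the lattice of subfunctors of `X`. -/
def imp (U V : Subfunctor X) : Subfunctor X where
  obj c := {x | ∀ ⦃e : C⦄ (f : c ⟶ e), X.map f x ∈ U.obj e → X.map f x ∈ V.obj e}
  map := by
    intro c c' i x hx e f hf
    have h := hx (i ≫ f)
    simp only [Functor.map_comp_apply] at h
    exact h hf

/-- `imp` is the Heyting implication. -/
theorem le_imp_iff (W U V : Subfunctor X) : W ≤ imp U V ↔ W ⊓ U ≤ V := by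
  constructor
  · rintro h c x ⟨hW, hU⟩
    have := h c hW (𝟙 c)
    simp only [Functor.map_id_apply] at this
    exact this hU
  · intro h c x hx e f hf
    exact h e ⟨W.map f hx, hf⟩

/-- Pseudo-complement. -/
def neg (U : Subfunctor X) : Subfunctor X := imp U ⊥

end CategoryTheory.Subfunctor

/-- A map `f : Y ⟶ X` is on top of the subobject `V` of `X` if, for every subobject `U` of `X`,
`f` factors through `U ∨ (U ⇒ V)`. -/
def IsOnTopOf {C : Type u} [Category.{v} C] {Y X : C ⥤ Type w₁} (f : Y ⟶ X)
    (V : Subfunctor X) : Prop :=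
  ∀ U : Subfunctor X, Subfunctor.range f ≤ U ⊔ Subfunctor.imp U V

/-- `X` is a sheaf for the double-negation (Lawvere-Tierney) topology: every map from a
`¬¬`-dense subobject `U` of an object `Y` to `X` extends uniquely to `Y`. -/
def IsNotNotSheaf {C : Type u} [Category.{v} C] : ObjectProperty (C ⥤ Type w₁) := fun X =>
  ∀ (Y : C ⥤ Type w₁) (U : Subfunctor Y), U.neg.neg = ⊤ →
    ∀ f : U.toFunctor ⟶ X, ∃! g : Y ⟶ X, U.ι ≫ g = f

/-- An idempotent (two-sided) ideal of a category. -/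
structure IdempotentIdeal (D : Type u) [Category.{v} D] where
  /-- The class of maps in the ideal. -/
  mem : MorphismProperty D
  precomp : ∀ ⦃X Y Z : D⦄ (f : X ⟶ Y) (g : Y ⟶ Z), mem g → mem (f ≫ g)
  postcomp : ∀ ⦃X Y Z : D⦄ (f : X ⟶ Y) (g : Y ⟶ Z), mem f → mem (f ≫ g)
  idem : ∀ ⦃X Z : D⦄ (f : X ⟶ Z), mem f →
    ∃ (Y : D) (h : X ⟶ Y) (g : Y ⟶ Z), mem h ∧ mem g ∧ h ≫ g = f

namespace IdempotentIdeal

variable {D : Type u} [Category.{v} D]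

/-- The Grothendieck topology of an idempotent ideal `I`: a sieve covers `X` if and only if it
contains every map with codomain `X` that is in `I`. -/
def topology (I : IdempotentIdeal D) : GrothendieckTopology D where
  sieves X := {S | ∀ ⦃Y : D⦄ (f : Y ⟶ X), I.mem f → S f}
  top_mem' _ _ _ _ := trivial
  pullback_stable' _ _ _ g hS _ f hf := hS (f ≫ g) (I.postcomp f g hf)
  transitive' X S hS R hR Y f hf := by
    obtain ⟨Z, h, g, hh, hg, rfl⟩ := I.idem f hf
    exact hR (hS g hg) h hh

/-- The idempotent ideal of a full subcategory: the maps that factor through one of its objects. -/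
def ofSubcategory (P : ObjectProperty D) : IdempotentIdeal D where
  mem X Z f := ∃ (Y : D) (_ : P Y) (h : X ⟶ Y) (g : Y ⟶ Z), h ≫ g = f
  precomp := by
    rintro X Y Z f _ ⟨W, hW, h, g, rfl⟩
    exact ⟨W, hW, f ≫ h, g, Category.assoc _ _ _⟩
  postcomp := by
    rintro X Y Z _ k ⟨W, hW, h, g, rfl⟩
    exact ⟨W, hW, h, g ≫ k, (Category.assoc _ _ _).symm⟩
  idem := by
    rintro X Z _ ⟨W, hW, h, g, rfl⟩
    exact ⟨W, h, g, ⟨W, hW, h, 𝟙 W, Category.comp_id _⟩, ⟨W, hW, 𝟙 W, g, Category.id_comp _⟩, rfl⟩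

end IdempotentIdeal

namespace Level

variable {D : Type u} [Category.{u} D]

/-- The level `l` of the topos of presheaves on `D` is the one that corresponds to the idempotent
ideal `I`: its subtopos consists of the sheaves for the topology of `I`. -/
def IsInducedBy (l : Level (Dᵒᵖ ⥤ Type u)) (I : IdempotentIdeal D) : Prop :=
  l.IsSubtoposOf (fun F => Presheaf.IsSheaf I.topology F)

/-- The counit (at `X`) of the principal comonad determined by the level `l`, as a subobject of
`X`: the image of the skeleton `l_! (l^* X) ⟶ X`. -/
def principal (l : Level (Dᵒᵖ ⥤ Type u)) (X : Dᵒᵖ ⥤ Type u) : Subfunctor X :=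
  Subfunctor.range (l.adjShriek.counit.app X)

/-- The full subcategory of the objects `d` of `D` whose identity is on top of the counit of the
principal comonad of `l` (the identity of `d` being regarded as a map between representables). -/
def successorSubcategory (l : Level (Dᵒᵖ ⥤ Type u)) : ObjectProperty D := fun d =>
  IsOnTopOf (yoneda.map (𝟙 d)) (l.principal (yoneda.obj d))

/-- The level `m` is the successor of the level `l`: `l` is induced by a full subcategory of `D`
that is closed under subobjects, and `m` is induced by the successor of that subcategory. -/
def IsSuccessor (l m : Level (Dᵒᵖ ⥤ Type u)) : Prop :=
  (∃ P : ObjectProperty D, P.IsClosedUnderSubobjects ∧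
    l.IsInducedBy (IdempotentIdeal.ofSubcategory P)) ∧
  m.IsInducedBy (IdempotentIdeal.ofSubcategory l.successorSubcategory)

end Level

/-- Every map of `D` is a split epimorphism followed by a monomorphism. -/
def HasSplitEpiMonoFactorizations (D : Type u) [Category.{v} D] : Prop :=
  ∀ ⦃X Z : D⦄ (f : X ⟶ Z), ∃ (Y : D) (e : X ⟶ Y) (m : Y ⟶ Z),
    IsSplitEpi e ∧ Mono m ∧ e ≫ m = f

/-! ### Points, discrete and codiscrete presheaves; pre-cohesion. -/

section Cohesion

variable (D : Type u) [SmallCategory D] [HasTerminal D]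

/-! Everything is governed by evaluation at `1`, which has the constant presheaves as left adjoint
and the codiscrete ones as right adjoint. Points make `Dᵒᵖ` sifted, so `colim`, left adjoint to the
constant presheaves, preserves finite products.

Points also make a subobject `¬¬`-dense exactly when it contains all global points. Hence codiscrete
presheaves, `¬¬`-sheaves and sheaves for the ideal of maps through `1` coincide, and form the
subtopos of `pointsLevel`.

For level `-∞` the skeleton is empty, so the successor condition on `d` is that every subobject of
its representable is complemented; testing on the maps that factor through a point forces `d ≅ 1`. A
level `n` is way-above `-∞` iff its subtopos contains the initial presheaf. Then any map inverted by
`n^*` is bijective on points (`bijective_points_of_isIso_inverse`), so codiscrete presheaves are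
retracts of their `n`-reflections and lie in `n`: `pointsLevel` is least. -/

/-- The global points of a presheaf: its value at the terminal object. -/
noncomputable abbrev pointsFunctor : (Dᵒᵖ ⥤ Type u) ⥤ Type u :=
  (evaluation Dᵒᵖ (Type u)).obj (op (⊤_ D))

/-- The codiscrete presheaf on `S` sends `d` to the set of `S`-valued functions on the points
of `d`. -/
noncomputable def codiscreteFunctor : Type u ⥤ (Dᵒᵖ ⥤ Type u) where
  obj S :=
    { obj d := (⊤_ D ⟶ d.unop) → S
      map f := ↾ fun g a => g (a ≫ f.unop) }
  map s := { app d := ↾ fun g a => s (g a) }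

/-- Discrete presheaves are left adjoint to global points. -/
noncomputable def discretePointsAdj : Functor.const Dᵒᵖ ⊣ pointsFunctor D :=
  Adjunction.mkOfHomEquiv
    { homEquiv S Y :=
        { toFun φ := φ.app (op (⊤_ D))
          invFun h :=
            { app d := h ≫ Y.map (terminal.from d.unop).op
              naturality d e f := by
                have : (terminal.from d.unop).op ≫ f = (terminal.from e.unop).op :=
                  Quiver.Hom.unop_inj (Subsingleton.elim _ _)
                simp [← Y.map_comp, this] }
          left_inv φ := by
            ext d : 2
            have := φ.naturality (terminal.from d.unop).op
            simpa using this.symm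
          right_inv h := by
            have : (terminal.from (⊤_ D)).op = 𝟙 _ :=
              Quiver.Hom.unop_inj (Subsingleton.elim _ _)
            simp [this] } }

/-- Global points are left adjoint to codiscrete presheaves. -/
noncomputable def pointsCodiscreteAdj : pointsFunctor D ⊣ codiscreteFunctor D :=
  Adjunction.mkOfHomEquiv
    { homEquiv Y S :=
        { toFun h :=
            { app d := ↾ fun y a => h (Y.map a.op y)
              naturality d e f := by
                ext y
                funext a
                change h (Y.map a.op (Y.map f y)) = h (Y.map (a ≫ f.unop).op y)
                simp }
          invFun φ := ↾ fun y => φ.app (op (⊤_ D)) y (𝟙 _)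
          left_inv h := by
            ext y
            change h (Y.map (𝟙 _) y) = h y
            simp
          right_inv φ := by
            ext d y
            funext a
            refine (congrFun (ConcreteCategory.congr_hom (φ.naturality a.op) y) (𝟙 _)).trans ?_
            change φ.app d y (𝟙 _ ≫ a) = φ.app d y a
            rw [Category.id_comp] }
      homEquiv_naturality_left_symm f g := by
        ext y
        simp
      homEquiv_naturality_right f g := by
        rfl }

instance : (codiscreteFunctor D).Faithful where
  map_injective {S T f g} h := by
    ext s
    exact congrFun (ConcreteCategory.congr_hom (NatTrans.congr_app h (op (⊤_ D)))
      (fun _ => s)) (𝟙 _)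

instance : (codiscreteFunctor D).Full where
  map_surjective {S T} φ := by
    refine ⟨↾ fun s => φ.app (op (⊤_ D)) (fun _ => s) (𝟙 _), ?_⟩
    ext d g
    funext a
    -- As `1` has one point, restricting `g` along `a` gives a constant function; naturality of `φ`
    -- at `a` then determines `φ` pointwise.
    have hg : (fun _ : ⊤_ D ⟶ ⊤_ D => g a) = ((codiscreteFunctor D).obj S).map a.op g := by
      funext b
      change g a = g (b ≫ a)
      rw [Subsingleton.elim b (𝟙 _), Category.id_comp]
    change φ.app (op (⊤_ D)) (fun _ : ⊤_ D ⟶ ⊤_ D => g a) (𝟙 _) = φ.app d g a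
    rw [hg]
    refine (congrFun (ConcreteCategory.congr_hom (φ.naturality a.op) g) (𝟙 _)).trans ?_
    change φ.app d g (𝟙 _ ≫ a) = φ.app d g a
    rw [Category.id_comp]

instance : (Functor.const Dᵒᵖ : Type u ⥤ _).Full where
  map_surjective {S T} φ := by
    refine ⟨φ.app (op (⊤_ D)), ?_⟩
    ext d : 2
    have := φ.naturality (terminal.from d.unop).op
    simpa using this.symm

instance : (Functor.const Dᵒᵖ : Type u ⥤ _).Faithful where
  map_injective h := NatTrans.congr_app h (op (⊤_ D))

variable {D}

/-- Restriction preserves the value of an element in the ambient constant presheaf. So restriction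
along `d ⟶ 1` is injective, and `x` over `d` comes from its own restriction to any point of `d`. -/
theorem isClosedUnderSubobjects_essImage_const (hpoint : ∀ d : D, Nonempty (⊤_ D ⟶ d)) :
    (Functor.const Dᵒᵖ : Type u ⥤ _).essImage.IsClosedUnderSubobjects where
  prop_of_mono {X Y} f _ hY := by
    obtain ⟨S, ⟨e⟩⟩ := hY
    have hinj : ∀ d, Function.Injective ((f ≫ e.inv).app d) := fun d =>
      (mono_iff_injective _).1 inferInstance
    have hmap : ∀ {d d' : Dᵒᵖ} (k : d ⟶ d') (x : X.obj d),
        (f ≫ e.inv).app d' (X.map k x) = (f ≫ e.inv).app d x := fun k x => by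
      simp
    have : IsIso ((discretePointsAdj D).counit.app X) := by
      rw [NatTrans.isIso_iff_isIso_app]
      intro d
      rw [isIso_iff_bijective]
      have hc : (((discretePointsAdj D).counit.app X).app d) =
          X.map (terminal.from d.unop).op := by
        simp [discretePointsAdj]
      rw [hc]
      refine ⟨fun x y hxy => hinj _ ?_, fun x => ?_⟩
      · rw [← hmap (terminal.from d.unop).op x, ← hmap (terminal.from d.unop).op y]
        exact congrArg _ hxy
      · obtain ⟨a⟩ := hpoint d.unop
        refine ⟨X.map a.op x, hinj _ ?_⟩
        rw [hmap]
        exact hmap a.op x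
    exact ⟨_, ⟨asIso ((discretePointsAdj D).counit.app X)⟩⟩

theorem isSifted_op (hpoint : ∀ d : D, Nonempty (⊤_ D ⟶ d)) : IsSifted Dᵒᵖ := by
  have : Nonempty Dᵒᵖ := ⟨op (⊤_ D)⟩
  have : (Functor.diag Dᵒᵖ).Final := by
    constructor
    rintro ⟨c₁, c₂⟩
    let pt (a : c₁ ⟶ op (⊤_ D)) (b : c₂ ⟶ op (⊤_ D)) :
        StructuredArrow (c₁, c₂) (Functor.diag Dᵒᵖ) :=
      StructuredArrow.mk (Y := op (⊤_ D)) (Prod.mkHom a b)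
    obtain ⟨a₀⟩ := hpoint c₁.unop
    obtain ⟨b₀⟩ := hpoint c₂.unop
    have : Nonempty (StructuredArrow (c₁, c₂) (Functor.diag Dᵒᵖ)) := ⟨pt a₀.op b₀.op⟩
    -- In `D` the objects are spans over `c₁` and `c₂`. The span with apex `c₁` and legs the
    -- identity and a constant map restricts to `pt a' b` for every `a'`, so the first point can be
    -- changed freely.
    have h₁ : ∀ a b, Zigzag (pt a b) (pt a₀.op b) := fun a b => by
      let X : StructuredArrow (c₁, c₂) (Functor.diag Dᵒᵖ) :=
        StructuredArrow.mk (Y := c₁) (Prod.mkHom (𝟙 c₁) (b ≫ (terminal.from c₁.unop).op))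
      have h : ∀ a' : c₁ ⟶ op (⊤_ D), Zag X (pt a' b) := fun a' =>
        Zag.of_hom (StructuredArrow.homMk a' (by
          have : (terminal.from c₁.unop).op ≫ a' = 𝟙 _ :=
            Quiver.Hom.unop_inj (Subsingleton.elim _ _)
          ext <;> simp [X, pt, this]))
      exact (Zigzag.of_zag (h a).symm).trans (Zigzag.of_zag (h a₀.op))
    have h₂ : ∀ a b, Zigzag (pt a b) (pt a b₀.op) := fun a b => by
      let X : StructuredArrow (c₁, c₂) (Functor.diag Dᵒᵖ) :=
        StructuredArrow.mk (Y := c₂) (Prod.mkHom (a ≫ (terminal.from c₂.unop).op) (𝟙 c₂))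
      have h : ∀ b' : c₂ ⟶ op (⊤_ D), Zag X (pt a b') := fun b' =>
        Zag.of_hom (StructuredArrow.homMk b' (by
          have : (terminal.from c₂.unop).op ≫ b' = 𝟙 _ :=
            Quiver.Hom.unop_inj (Subsingleton.elim _ _)
          ext <;> simp [X, pt, this]))
      exact (Zigzag.of_zag (h b).symm).trans (Zigzag.of_zag (h b₀.op))
    -- A point of the apex turns any span into a pair of points.
    have h₃ : ∀ X, Zigzag X (pt a₀.op b₀.op) := fun X => by
      obtain ⟨x⟩ := hpoint X.right.unop
      have h : Zag X (pt (X.hom.1 ≫ x.op) (X.hom.2 ≫ x.op)) :=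
        Zag.of_hom (StructuredArrow.homMk x.op rfl)
      exact (Zigzag.of_zag h).trans ((h₁ _ _).trans (h₂ _ _))
    exact zigzag_isConnected fun X Y => (h₃ X).trans (zigzag_symm.symm _ _ (h₃ Y))
  have : IsSiftedOrEmpty Dᵒᵖ := this
  exact {}

/-- The presheaf topos on a small category with a terminal object, all of whose objects have a
point, is pre-cohesive over sets. -/
noncomputable def preCohesivePresheaf (hpoint : ∀ d : D, Nonempty (⊤_ D ⟶ d)) :
    PreCohesive (Dᵒᵖ ⥤ Type u) (Type u) where
  pieces := colim
  discrete := Functor.const Dᵒᵖ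
  points := pointsFunctor D
  codiscrete := codiscreteFunctor D
  adjPieces := colimConstAdj
  adjDiscrete := discretePointsAdj D
  adjPoints := pointsCodiscreteAdj D
  codiscrete_full := inferInstance
  codiscrete_faithful := inferInstance
  discrete_full := inferInstance
  discrete_faithful := inferInstance
  discrete_closed := isClosedUnderSubobjects_essImage_const hpoint
  pieces_products :=
    have := isSifted_op hpoint
    inferInstance

variable (D) in
/-- The level of presheaf toposes given by discrete and codiscrete presheaves. -/
noncomputable def pointsLevel : Level (Dᵒᵖ ⥤ Type u) where
  L := Type u
  shriek := Functor.const Dᵒᵖ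
  inverse := pointsFunctor D
  direct := codiscreteFunctor D
  adjShriek := discretePointsAdj D
  adjDirect := pointsCodiscreteAdj D
  shriek_full := inferInstance
  shriek_faithful := inferInstance
  direct_full := inferInstance
  direct_faithful := inferInstance

end Cohesion

/-! ### Codiscrete presheaves are the `¬¬`-sheaves. -/

section Codiscrete

variable {D : Type u} [SmallCategory D] [HasTerminal D]

/-- Every function on the points of `d` with values in the points of `X` comes from a unique
element of `X` at `d`. -/
def IsPointwise (X : Dᵒᵖ ⥤ Type u) : Prop :=
  ∀ (d : D) (g : (⊤_ D ⟶ d) → X.obj (op (⊤_ D))), ∃! x : X.obj (op d), ∀ a, X.map a.op x = g a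

theorem IsPointwise.mem_essImage {X : Dᵒᵖ ⥤ Type u} (hX : IsPointwise X) :
    (codiscreteFunctor D).essImage X := by
  have : IsIso ((pointsCodiscreteAdj D).unit.app X) := by
    rw [NatTrans.isIso_iff_isIso_app]
    intro d
    rw [isIso_iff_bijective, Function.bijective_iff_existsUnique]
    intro g
    obtain ⟨x, hx, hx'⟩ := hX d.unop g
    exact ⟨x, funext hx, fun y hy => hx' y (congrFun hy)⟩
  exact ⟨_, ⟨(asIso ((pointsCodiscreteAdj D).unit.app X)).symm⟩⟩

/-- Codiscrete presheaves see every map that is bijective on points as an isomorphism. -/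
theorem existsUnique_extension_of_essImage {X : Dᵒᵖ ⥤ Type u}
    (hX : (codiscreteFunctor D).essImage X) {A Y : Dᵒᵖ ⥤ Type u} (i : A ⟶ Y)
    (hi : Function.Bijective (i.app (op (⊤_ D)))) (f : A ⟶ X) : ∃! g : Y ⟶ X, i ≫ g = f := by
  obtain ⟨S, ⟨e⟩⟩ := hX
  have hi' : IsIso ((pointsFunctor D).map i) := (isIso_iff_bijective _).2 hi
  let adj := pointsCodiscreteAdj D
  refine ⟨adj.homEquiv _ _ (inv ((pointsFunctor D).map i) ≫ (adj.homEquiv _ _).symm (f ≫ e.inv)) ≫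
    e.hom, ?_, fun g hg => ?_⟩
  · dsimp only
    rw [← Category.assoc, ← adj.homEquiv_naturality_left, IsIso.hom_inv_id_assoc,
      Equiv.apply_symm_apply, Category.assoc, e.inv_hom_id, Category.comp_id]
  · rw [← hg, Category.assoc, adj.homEquiv_naturality_left_symm, IsIso.inv_hom_id_assoc,
      Equiv.apply_symm_apply, Category.assoc, e.inv_hom_id, Category.comp_id]

/-- A subobject is `¬¬`-dense precisely when it contains all points. -/
theorem neg_neg_eq_top_iff (hpoint : ∀ d : D, Nonempty (⊤_ D ⟶ d)) {Y : Dᵒᵖ ⥤ Type u}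
    (U : Subfunctor Y) : U.neg.neg = ⊤ ↔ ∀ y : Y.obj (op (⊤_ D)), y ∈ U.obj (op (⊤_ D)) := by
  constructor
  · intro h y
    by_contra hy
    have hy' : y ∈ U.neg.neg.obj (op (⊤_ D)) := by rw [h]; trivial
    -- If `y` restricted to `e` were in `U`, restricting further along a point of `e` would return
    -- `y` itself.
    refine hy' (𝟙 _) fun e f hf => ?_
    obtain ⟨a⟩ := hpoint e.unop
    have ha : f ≫ a.op = 𝟙 _ := Quiver.Hom.unop_inj (Subsingleton.elim _ _)
    have := U.map a.op hf
    simp only [Functor.map_id_apply] at this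
    rw [Set.mem_preimage, ← Functor.map_comp_apply, ha, Functor.map_id_apply] at this
    exact hy this
  · intro h
    rw [eq_top_iff]
    intro c x _ e f hf
    obtain ⟨a⟩ := hpoint e.unop
    refine hf a.op ?_
    exact h _

theorem isNotNotSheaf_of_essImage (hpoint : ∀ d : D, Nonempty (⊤_ D ⟶ d)) {X : Dᵒᵖ ⥤ Type u}
    (hX : (codiscreteFunctor D).essImage X) : IsNotNotSheaf X := fun _ U hU f =>
  existsUnique_extension_of_essImage hX U.ι
    ⟨fun _ _ h => Subtype.ext h, fun y => ⟨⟨y, (neg_neg_eq_top_iff hpoint U).1 hU y⟩, rfl⟩⟩ f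

variable (D) in
/-- The objects that are isomorphic to the terminal object. -/
def isoTerminal : ObjectProperty D := fun d => Nonempty (d ≅ ⊤_ D)

theorem mem_ofSubcategory_isoTerminal {d e : D} (f : e ⟶ d) :
    (IdempotentIdeal.ofSubcategory (isoTerminal D)).mem f ↔
      ∃ a : ⊤_ D ⟶ d, f = terminal.from e ≫ a := by
  constructor
  · rintro ⟨c, ⟨i⟩, h, g, rfl⟩
    refine ⟨i.inv ≫ g, ?_⟩
    rw [← Subsingleton.elim (h ≫ i.hom) (terminal.from e)]
    simp
  · rintro ⟨a, rfl⟩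
    exact ⟨_, ⟨Iso.refl _⟩, _, _, rfl⟩

/-- A covering sieve contains every point of `d`, so its inclusion into the representable is
bijective on points. -/
theorem isSheaf_of_essImage {X : Dᵒᵖ ⥤ Type u} (hX : (codiscreteFunctor D).essImage X) :
    Presheaf.IsSheaf (IdempotentIdeal.ofSubcategory (isoTerminal D)).topology X := by
  rw [isSheaf_iff_isSheaf_of_type]
  intro d S hS
  rw [Presieve.isSheafFor_iff_yonedaSheafCondition]
  refine existsUnique_extension_of_essImage hX S.functorInclusion
    ⟨fun _ _ h => Subtype.ext h, fun y => ⟨⟨y, hS y ?_⟩, rfl⟩⟩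
  exact (mem_ofSubcategory_isoTerminal y).2
    ⟨y, by rw [Subsingleton.elim (terminal.from (⊤_ D)) (𝟙 _), Category.id_comp]⟩

/-- The sieve of maps to `d` that factor through a point of `d`. -/
def constantSieve (d : D) : Sieve d where
  arrows e f := ∃ a : ⊤_ D ⟶ d, f = terminal.from e ≫ a
  downward_closed := by
    rintro e e' _ ⟨a, rfl⟩ k
    exact ⟨a, by rw [← Category.assoc, Subsingleton.elim (k ≫ _) (terminal.from e')]⟩

theorem constantSieve_terminal {d : D} (a : ⊤_ D ⟶ d) : constantSieve d a :=
  ⟨a, by rw [Subsingleton.elim (terminal.from (⊤_ D)) (𝟙 _), Category.id_comp]⟩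

/-- A function `g` on points amounts to a map `φ` from the sieve of constant maps to `X`; its
extensions to the representable are the elements that restrict to `g`. -/
theorem isPointwise_of_yonedaSheafCondition (hpoint : ∀ d : D, Nonempty (⊤_ D ⟶ d))
    {X : Dᵒᵖ ⥤ Type u}
    (hX : ∀ d : D, Presieve.YonedaSheafCondition X (constantSieve d)) : IsPointwise X := by
  intro d g
  -- A constant map `f` has value `pt e ≫ f`, whichever point of `e` is chosen.
  let pt (e : D) : ⊤_ D ⟶ e := (hpoint e).some
  have hconst : ∀ {e : D} (b b' : ⊤_ D ⟶ e) {f : e ⟶ d}, constantSieve d f → b ≫ f = b' ≫ f := by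
    rintro e b b' _ ⟨a, rfl⟩
    simp only [← Category.assoc]
    rw [Subsingleton.elim (b ≫ terminal.from e) (b' ≫ terminal.from e)]
  have hpt : ∀ {e : D} {f : e ⟶ d}, constantSieve d f → f = terminal.from e ≫ pt e ≫ f := by
    rintro e _ ⟨a, rfl⟩
    simp only [← Category.assoc]
    rw [Subsingleton.elim ((terminal.from e ≫ pt e) ≫ terminal.from e) (terminal.from e)]
  have hfrom : ∀ {e e' : D} (k : e' ⟶ e) (x : X.obj (op (⊤_ D))),
      X.map k.op (X.map (terminal.from e).op x) = X.map (terminal.from e').op x := by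
    intro e e' k x
    rw [← Functor.map_comp_apply, ← op_comp, Subsingleton.elim (k ≫ _) (terminal.from e')]
  let φ : (constantSieve d).functor ⟶ X :=
    { app e := ↾ fun f => X.map (terminal.from e.unop).op (g (pt e.unop ≫ f.1))
      naturality e e' k := by
        ext f
        refine Eq.trans ?_ (hfrom k.unop _).symm
        change X.map _ (g (pt e'.unop ≫ k.unop ≫ f.1)) = X.map _ (g (pt e.unop ≫ f.1))
        rw [← Category.assoc, hconst _ (pt e.unop) f.2] }
  obtain ⟨ψ, hψ, huniq⟩ := hX d φ
  have hext : ∀ x : X.obj (op d), (∀ a, X.map a.op x = g a) ↔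
      (constantSieve d).functorInclusion ≫ yonedaEquiv.symm x = φ := by
    intro x
    constructor
    · intro hx
      ext e f
      obtain ⟨f, hf⟩ := f
      change X.map f.op x = X.map (terminal.from e.unop).op (g (pt e.unop ≫ f))
      rw [← hx, ← Functor.map_comp_apply, ← op_comp, ← hpt hf]
    · intro hx a
      have := ConcreteCategory.congr_hom (NatTrans.congr_app hx (op (⊤_ D)))
        ⟨a, constantSieve_terminal a⟩
      refine Eq.trans this ?_
      change X.map (terminal.from (⊤_ D)).op (g (pt (⊤_ D) ≫ a)) = _
      rw [Subsingleton.elim (pt (⊤_ D)) (𝟙 _), Category.id_comp,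
        Subsingleton.elim (terminal.from (⊤_ D)) (𝟙 _), op_id, Functor.map_id_apply]
  refine ⟨yonedaEquiv ψ, ?_, fun x hx => ?_⟩
  · refine (hext _).2 ?_
    rwa [Equiv.symm_apply_apply]
  · rw [← huniq _ ((hext x).1 hx), Equiv.apply_symm_apply]

theorem isPointwise_of_isSheaf (hpoint : ∀ d : D, Nonempty (⊤_ D ⟶ d)) {X : Dᵒᵖ ⥤ Type u}
    (hX : Presheaf.IsSheaf (IdempotentIdeal.ofSubcategory (isoTerminal D)).topology X) :
    IsPointwise X := by
  rw [isSheaf_iff_isSheaf_of_type] at hX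
  refine isPointwise_of_yonedaSheafCondition hpoint fun d => ?_
  rw [← Presieve.isSheafFor_iff_yonedaSheafCondition]
  exact hX _ fun _ f hf => (mem_ofSubcategory_isoTerminal f).1 hf

theorem isPointwise_of_isNotNotSheaf (hpoint : ∀ d : D, Nonempty (⊤_ D ⟶ d))
    {X : Dᵒᵖ ⥤ Type u} (hX : IsNotNotSheaf X) : IsPointwise X := by
  refine isPointwise_of_yonedaSheafCondition hpoint fun d f => ?_
  let U : Subfunctor (yoneda.obj d) :=
    { obj e := {k | constantSieve d k}
      map k _ hl := (constantSieve d).downward_closed hl k.unop }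
  exact hX _ U ((neg_neg_eq_top_iff hpoint U).2 constantSieve_terminal) f

theorem isNotNotSheaf_iff_essImage (hpoint : ∀ d : D, Nonempty (⊤_ D ⟶ d))
    (X : Dᵒᵖ ⥤ Type u) : IsNotNotSheaf X ↔ (codiscreteFunctor D).essImage X :=
  ⟨fun h => (isPointwise_of_isNotNotSheaf hpoint h).mem_essImage,
    isNotNotSheaf_of_essImage hpoint⟩

theorem isSheaf_isoTerminal_iff_isNotNotSheaf (hpoint : ∀ d : D, Nonempty (⊤_ D ⟶ d))
    (X : Dᵒᵖ ⥤ Type u) :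
    Presheaf.IsSheaf (IdempotentIdeal.ofSubcategory (isoTerminal D)).topology X ↔
      IsNotNotSheaf X :=
  ⟨fun h => isNotNotSheaf_of_essImage hpoint (isPointwise_of_isSheaf hpoint h).mem_essImage,
    fun h => isSheaf_of_essImage ((isNotNotSheaf_iff_essImage hpoint X).1 h)⟩

theorem pointsLevel_isSubtoposOf (hpoint : ∀ d : D, Nonempty (⊤_ D ⟶ d)) :
    (pointsLevel D).IsSubtoposOf IsNotNotSheaf := fun X =>
  (isNotNotSheaf_iff_essImage hpoint X).symm

end Codiscrete

/-! ### Levels compared through essential images; level `-∞`. -/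

section Levels

theorem factorsThrough_iff_essImage {A B E : Type*} [Category* A] [Category* B] [Category* E]
    (F : A ⥤ E) (G : B ⥤ E) [G.Full] [G.Faithful] :
    FactorsThrough F G ↔ ∀ a, G.essImage (F.obj a) :=
  ⟨fun ⟨H, ⟨i⟩⟩ a => ⟨H.obj a, ⟨i.app a⟩⟩,
    fun h => ⟨Functor.essImage.liftFunctor F G h, ⟨Functor.essImage.liftFunctorCompIso F G h⟩⟩⟩

namespace Level

section General

variable {E : Type u} [Category.{v} E]

theorem le_iff_essImage (l m : Level E) : l ≤ m ↔ l.direct.essImage ≤ m.direct.essImage := by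
  have := m.direct_full
  have := m.direct_faithful
  refine (factorsThrough_iff_essImage _ _).trans ⟨?_, fun h a => h _ ⟨a, ⟨Iso.refl _⟩⟩⟩
  rintro h X ⟨Y, ⟨i⟩⟩
  exact ObjectProperty.prop_of_iso _ i (h Y)

theorem isWayAbove_iff_essImage (l m : Level E) : m.IsWayAbove l ↔
    l.direct.essImage ≤ m.direct.essImage ∧ l.shriek.essImage ≤ m.direct.essImage := by
  have := m.direct_full
  have := m.direct_faithful
  rw [IsWayAbove, le_iff_essImage, factorsThrough_iff_essImage]
  refine and_congr_right fun _ => ⟨?_, fun h a => h _ ⟨a, ⟨Iso.refl _⟩⟩⟩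
  rintro h X ⟨Y, ⟨i⟩⟩
  exact ObjectProperty.prop_of_iso _ i (h Y)

/-- The one-object type, as a terminal category in arbitrary universes. -/
inductive OneObject : Type u
  | star

instance : Category.{v} OneObject.{u} where
  Hom _ _ := PUnit
  id _ := ⟨⟩
  comp _ _ := ⟨⟩

variable (E) in
/-- The degenerate level. -/
noncomputable def minusInfinity [HasInitial E] [HasTerminal E] : Level E where
  L := OneObject.{u}
  shriek :=
    { obj _ := ⊥_ E
      map _ := 𝟙 _ }
  inverse :=
    { obj _ := .star
      map _ := ⟨⟩ }
  direct :=
    { obj _ := ⊤_ E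
      map _ := 𝟙 _ }
  adjShriek :=
    Adjunction.mkOfHomEquiv
      { homEquiv _ Y :=
          { toFun _ := ⟨⟩, invFun _ := initial.to Y, left_inv _ := initial.hom_ext _ _ }
        homEquiv_naturality_left_symm _ _ := initial.hom_ext _ _ }
  adjDirect :=
    Adjunction.mkOfHomEquiv
      { homEquiv X _ :=
          { toFun _ := terminal.from X, invFun _ := ⟨⟩, right_inv _ := terminal.hom_ext _ _ }
        homEquiv_naturality_right _ _ := terminal.hom_ext _ _ }
  shriek_full := ⟨fun _ => ⟨⟨⟩, initial.hom_ext _ _⟩⟩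
  shriek_faithful := ⟨fun _ => rfl⟩
  direct_full := ⟨fun _ => ⟨⟨⟩, terminal.hom_ext _ _⟩⟩
  direct_faithful := ⟨fun _ => rfl⟩

theorem isMinusInfinity_minusInfinity [HasInitial E] [HasTerminal E] :
    (minusInfinity E).IsMinusInfinity :=
  ⟨{ functor := { obj _ := ⟨⟨⟩⟩, map _ := 𝟙 _ }
     inverse :=
      { obj _ := OneObject.star
        map _ := (⟨⟩ : PUnit.{v + 1})
        map_id _ := rfl
        map_comp _ _ := rfl }
     unitIso := NatIso.ofComponents (fun _ => Iso.refl _) (fun _ => rfl)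
     counitIso := NatIso.ofComponents (fun _ => Iso.refl _)
     functor_unitIso_comp _ := rfl }⟩

variable {l : Level E}

theorem IsMinusInfinity.uniqueHom (hl : l.IsMinusInfinity) (A B : l.L) :
    Nonempty (Unique (A ⟶ B)) := by
  obtain ⟨e⟩ := hl
  have i : (A ⟶ B) ≃ (e.functor.obj A ⟶ e.functor.obj B) := e.fullyFaithfulFunctor.homEquiv
  have : Subsingleton (A ⟶ B) := i.subsingleton
  exact ⟨⟨⟨i.symm (eqToHom (Subsingleton.elim _ _))⟩, fun _ => Subsingleton.elim _ _⟩⟩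

theorem IsMinusInfinity.nonempty (hl : l.IsMinusInfinity) : Nonempty l.L :=
  ⟨hl.some.inverse.obj ⟨⟨⟩⟩⟩

theorem IsMinusInfinity.essImage_shriek_iff (hl : l.IsMinusInfinity) (X : E) :
    l.shriek.essImage X ↔ Nonempty (IsInitial X) := by
  have h : ∀ A, Nonempty (IsInitial (l.shriek.obj A)) := fun A =>
    ⟨IsInitial.ofUniqueHom
      (fun Y => (l.adjShriek.homEquiv A Y).symm (hl.uniqueHom _ _).some.default) fun Y f => by
        rw [Equiv.eq_symm_apply]
        exact (hl.uniqueHom _ _).some.uniq _⟩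
  constructor
  · rintro ⟨A, ⟨i⟩⟩
    exact ⟨(h A).some.ofIso i⟩
  · rintro ⟨hX⟩
    exact ⟨hl.nonempty.some, ⟨(h _).some.uniqueUpToIso hX⟩⟩

theorem IsMinusInfinity.essImage_direct_iff (hl : l.IsMinusInfinity) (X : E) :
    l.direct.essImage X ↔ Nonempty (IsTerminal X) := by
  have h : ∀ A, Nonempty (IsTerminal (l.direct.obj A)) := fun A =>
    ⟨IsTerminal.ofUniqueHom
      (fun Y => l.adjDirect.homEquiv Y A (hl.uniqueHom _ _).some.default) fun Y f => by
        rw [← Equiv.symm_apply_eq]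
        exact (hl.uniqueHom _ _).some.uniq _⟩
  constructor
  · rintro ⟨A, ⟨i⟩⟩
    exact ⟨(h A).some.ofIso i⟩
  · rintro ⟨hX⟩
    exact ⟨hl.nonempty.some, ⟨(h _).some.uniqueUpToIso hX⟩⟩

/-- The order condition is automatic: the unit at a terminal object is split mono, so every
reflective subcategory contains it. Only the image of `l_!`, the initial objects, imposes a
condition. -/
theorem IsMinusInfinity.isWayAbove_iff (hl : l.IsMinusInfinity) [HasInitial E] (m : Level E) :
    m.IsWayAbove l ↔ m.direct.essImage (⊥_ E) := by
  rw [isWayAbove_iff_essImage]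
  constructor
  · intro h
    exact h.2 _ ((hl.essImage_shriek_iff _).2 ⟨initialIsInitial⟩)
  · refine fun h => ⟨fun X hX => ?_, fun X hX => ?_⟩
    · obtain ⟨hX⟩ := (hl.essImage_direct_iff X).1 hX
      have := m.direct_full
      have := m.direct_faithful
      let R : Reflective m.direct := { L := m.inverse, adj := m.adjDirect }
      have : IsSplitMono ((reflectorAdjunction m.direct).unit.app X) :=
        ⟨⟨⟨hX.from _, hX.hom_ext _ _⟩⟩⟩
      exact mem_essImage_of_unit_isSplitMono
    · obtain ⟨hX⟩ := (hl.essImage_shriek_iff X).1 hX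
      exact ObjectProperty.prop_of_iso _ (initialIsInitial.uniqueUpToIso hX) h

end General

/-! ### The successor of level `-∞`. -/

variable {D : Type u} [SmallCategory D]

theorem isEmpty_of_isInitial {X : Dᵒᵖ ⥤ Type u} (hX : IsInitial X) (d : Dᵒᵖ) :
    IsEmpty (X.obj d) :=
  ⟨fun x => ((hX.to ((Functor.const _).obj PEmpty)).app d x : PEmpty).elim⟩

/-- A presheaf without elements is initial. -/
theorem isInitial_of_isEmpty {X : Dᵒᵖ ⥤ Type u} (hX : ∀ d, IsEmpty (X.obj d)) :
    Nonempty (IsInitial X) :=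
  ⟨IsInitial.ofUniqueHom
    (fun Y => { app d := ↾ fun x => ((hX d).false x).elim
                naturality d _ _ := by ext x; exact ((hX d).false x).elim })
    fun Y f => by ext d x; exact ((hX d).false x).elim⟩

/-- The ideal is empty, so the empty sieve covers, and gluing the empty family makes each value a
singleton. -/
theorem isSheaf_bot_iff (X : Dᵒᵖ ⥤ Type u) :
    Presheaf.IsSheaf (IdempotentIdeal.ofSubcategory (⊥ : ObjectProperty D)).topology X ↔
      Nonempty (IsTerminal X) := by
  rw [isSheaf_iff_isSheaf_of_type]
  constructor
  · intro h
    have hu : ∀ d : D, ∃! _ : X.obj (op d), True := fun d => by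
      have hb : (⊥ : Sieve d) ∈
          (IdempotentIdeal.ofSubcategory (⊥ : ObjectProperty D)).topology d := by
        rintro Y f ⟨W, hW, _⟩
        exact hW.elim
      obtain ⟨x, -, hx⟩ := h _ hb (fun _ _ hf => hf.elim) (fun _ _ _ _ _ _ _ hf => hf.elim)
      exact ⟨x, trivial, fun y _ => hx y fun _ _ hf => hf.elim⟩
    choose x _ hx using hu
    exact ⟨IsTerminal.ofUniqueHom
      (fun Y => { app d := ↾ fun _ => x d.unop
                  naturality d e f := by ext y; exact (hx _ _ trivial).symm })
      fun Y f => by ext d y; exact hx _ _ trivial⟩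
  · rintro ⟨hX⟩ d S _
    rw [Presieve.isSheafFor_iff_yonedaSheafCondition]
    exact fun f => ⟨hX.from _, hX.hom_ext _ _, fun _ _ => hX.hom_ext _ _⟩

theorem IsMinusInfinity.isInducedBy_bot {l : Level (Dᵒᵖ ⥤ Type u)} (hl : l.IsMinusInfinity) :
    l.IsInducedBy (IdempotentIdeal.ofSubcategory ⊥) := fun X =>
  (hl.essImage_direct_iff X).trans (isSheaf_bot_iff X).symm

theorem IsMinusInfinity.principal_eq_bot {l : Level (Dᵒᵖ ⥤ Type u)} (hl : l.IsMinusInfinity)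
    (X : Dᵒᵖ ⥤ Type u) : l.principal X = ⊥ := by
  rw [eq_bot_iff]
  rintro d _ ⟨y, -⟩
  obtain ⟨h⟩ := (hl.essImage_shriek_iff _).1 (l.shriek.obj_mem_essImage (l.inverse.obj X))
  exact ((isEmpty_of_isInitial h d).false y).elim

variable [HasTerminal D]

theorem IsMinusInfinity.successorSubcategory_eq {l : Level (Dᵒᵖ ⥤ Type u)}
    (hl : l.IsMinusInfinity) (hpoint : ∀ d : D, Nonempty (⊤_ D ⟶ d)) :
    l.successorSubcategory = isoTerminal D := by
  ext d
  simp only [successorSubcategory, IsOnTopOf, hl.principal_eq_bot]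
  constructor
  · intro h
    let U : Subfunctor (yoneda.obj d) :=
      { obj e := {k | constantSieve d k}
        map k _ hl := (constantSieve d).downward_closed hl k.unop }
    obtain hU | hU := h U (op d) (show 𝟙 d ∈ _ from ⟨𝟙 d, Category.comp_id _⟩)
    · obtain ⟨a, ha⟩ := hU
      exact ⟨⟨terminal.from d, a, ha.symm, Subsingleton.elim _ _⟩⟩
    · obtain ⟨a⟩ := hpoint d
      refine (hU a.op ?_).elim
      change constantSieve d (a ≫ 𝟙 d)
      rw [Category.comp_id]
      exact constantSieve_terminal a
  · rintro ⟨i⟩ U e f -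
    by_cases hf : f ∈ U.obj e
    · exact Or.inl hf
    · refine Or.inr fun e' k hk => hf ?_
      obtain ⟨a⟩ := hpoint e'.unop
      have ht : ∀ {c : D} (g g' : c ⟶ d), g = g' := fun g g' => by
        rw [← cancel_mono i.hom]
        exact Subsingleton.elim _ _
      -- Membership in `U` travels from `e'` back to `e` along `e ⟶ 1 ⟶ e'`; all maps into `d` are
      -- equal.
      have := U.map (terminal.from e.unop ≫ a).op hk
      rw [Set.mem_preimage] at this
      convert this using 1
      exact ht _ _

theorem IsMinusInfinity.isSuccessor_iff {l : Level (Dᵒᵖ ⥤ Type u)} (hl : l.IsMinusInfinity)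
    (hpoint : ∀ d : D, Nonempty (⊤_ D ⟶ d)) (m : Level (Dᵒᵖ ⥤ Type u)) :
    l.IsSuccessor m ↔ m.IsSubtoposOf IsNotNotSheaf := by
  rw [IsSuccessor, hl.successorSubcategory_eq hpoint, IsInducedBy, IsSubtoposOf, IsSubtoposOf]
  simp only [isSheaf_isoTerminal_iff_isNotNotSheaf hpoint]
  exact and_iff_right ⟨⊥, ⟨fun _ _ h => h⟩, hl.isInducedBy_bot⟩

/-! ### The Aufhebung of level `-∞`. -/

/-- If the initial presheaf is in the subtopos of the level `n`, then a point of `Y` that lifts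
along `p` after applying the inverse image of `n` already lifts along `p`. -/
theorem exists_lift_of_inverse {n : Level (Dᵒᵖ ⥤ Type u)} (hn : n.direct.essImage (⊥_ _))
    {X Y : Dᵒᵖ ⥤ Type u} (hpoint : ∀ d : D, Nonempty (⊤_ D ⟶ d)) (p : X ⟶ Y)
    (b : yoneda.obj (⊤_ D) ⟶ Y)
    (k : n.inverse.obj (yoneda.obj (⊤_ D)) ⟶ n.inverse.obj X)
    (hk : k ≫ n.inverse.map p = n.inverse.map b) :
    ∃ x : X.obj (op (⊤_ D)), p.app _ x = b.app _ (𝟙 (⊤_ D)) := by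
  by_contra! hne
  have := n.direct_full
  have := n.direct_faithful
  have : n.inverse.IsRightAdjoint := n.adjShriek.isRightAdjoint
  -- Without a lift this pullback is empty, hence in `n`. As a right adjoint, `n^*` preserves it, so
  -- `k` yields a map from `n^* 1` to its image, whose transpose gives it a point.
  have hP := IsPullback.of_hasPullback p b
  have hempty : ∀ d, IsEmpty ((pullback p b).obj d) := fun d => ⟨fun z => by
    obtain ⟨a⟩ := hpoint d.unop
    let z' : (pullback p b).obj (op (⊤_ D)) := (pullback p b).map a.op z
    apply hne ((pullback.fst p b).app _ z')
    have h := ConcreteCategory.congr_hom (NatTrans.congr_app (pullback.condition (f := p) (g := b))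
      (op (⊤_ D))) z'
    refine Eq.trans h ?_
    change b.app _ ((pullback.snd p b).app _ z') = _
    exact congrArg (b.app _)
      (@Subsingleton.elim (⊤_ D ⟶ ⊤_ D) _ ((pullback.snd p b).app _ z') (𝟙 _))⟩
  obtain ⟨hI⟩ := isInitial_of_isEmpty hempty
  have hmem : n.direct.essImage (pullback p b) :=
    ObjectProperty.prop_of_iso _ (initialIsInitial.uniqueUpToIso hI) hn
  let R : Reflective n.direct := { L := n.inverse, adj := n.adjDirect }
  have : IsIso (n.adjDirect.unit.app (pullback p b)) := Functor.essImage.unit_isIso hmem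
  let s := (hP.map n.inverse).lift k (𝟙 _) (by rw [hk, Category.id_comp])
  let t := n.adjDirect.homEquiv _ _ s ≫ inv (n.adjDirect.unit.app (pullback p b))
  exact (hempty (op (⊤_ D))).false (t.app _ (𝟙 (⊤_ D)))

theorem bijective_points_of_isIso_inverse {n : Level (Dᵒᵖ ⥤ Type u)}
    (hn : n.direct.essImage (⊥_ _)) {X Y : Dᵒᵖ ⥤ Type u}
    (hpoint : ∀ d : D, Nonempty (⊤_ D ⟶ d)) (f : X ⟶ Y) [IsIso (n.inverse.map f)] :
    Function.Bijective (f.app (op (⊤_ D))) := by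
  constructor
  · intro x x' h
    have h' : yonedaEquiv.symm x ≫ f = yonedaEquiv.symm x' ≫ f := by
      rw [yonedaEquiv_symm_naturality_right, yonedaEquiv_symm_naturality_right]
      exact congrArg _ h
    have h'' : n.inverse.map (yonedaEquiv.symm x) = n.inverse.map (yonedaEquiv.symm x') := by
      rw [← cancel_mono (n.inverse.map f), ← Functor.map_comp, h', Functor.map_comp]
    -- Since `n^*` identifies `x` and `x'`, one factors through the other by an endomorphism of `1`,
    -- which is the identity.
    obtain ⟨t, ht⟩ := exists_lift_of_inverse hn hpoint (yonedaEquiv.symm x) (yonedaEquiv.symm x')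
      (𝟙 _) (by rw [Category.id_comp, h''])
    change X.map _ x = X.map _ x' at ht
    rwa [@Subsingleton.elim (⊤_ D ⟶ ⊤_ D) _ t (𝟙 _), op_id, Functor.map_id_apply, Functor.map_id_apply] at ht
  · intro y
    obtain ⟨x, hx⟩ := exists_lift_of_inverse hn hpoint f (yonedaEquiv.symm y)
      (n.inverse.map (yonedaEquiv.symm y) ≫ inv (n.inverse.map f)) (by simp)
    refine ⟨x, hx.trans ?_⟩
    change Y.map (𝟙 _).op y = y
    simp

/-- The unit at `X` is inverted by `n^*`, hence bijective on points; a codiscrete `X` therefore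
extends its identity along it, giving a retraction. -/
theorem essImage_codiscrete_le {n : Level (Dᵒᵖ ⥤ Type u)} (hn : n.direct.essImage (⊥_ _))
    (hpoint : ∀ d : D, Nonempty (⊤_ D ⟶ d)) :
    (codiscreteFunctor D).essImage ≤ n.direct.essImage := by
  intro X hX
  have := n.direct_full
  have := n.direct_faithful
  let R : Reflective n.direct := { L := n.inverse, adj := n.adjDirect }
  have : IsIso (n.inverse.map (n.adjDirect.unit.app X)) :=
    isIso_of_comp_hom_eq_id _ (n.adjDirect.left_triangle_components X)
  obtain ⟨r, hr, -⟩ := existsUnique_extension_of_essImage hX _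
    (bijective_points_of_isIso_inverse hn hpoint (n.adjDirect.unit.app X)) (𝟙 X)
  have : IsSplitMono ((reflectorAdjunction n.direct).unit.app X) := ⟨⟨⟨r, hr⟩⟩⟩
  exact mem_essImage_of_unit_isSplitMono

theorem IsMinusInfinity.isAufhebung_iff {l : Level (Dᵒᵖ ⥤ Type u)} (hl : l.IsMinusInfinity)
    (hpoint : ∀ d : D, Nonempty (⊤_ D ⟶ d)) (m : Level (Dᵒᵖ ⥤ Type u)) :
    l.IsAufhebung m ↔ m.IsSubtoposOf IsNotNotSheaf := by
  -- Each `d` has a point, so no function goes from its points to the empty set.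
  have h0 : (codiscreteFunctor D).essImage (⊥_ _) := by
    refine IsPointwise.mem_essImage fun d g => ?_
    obtain ⟨a⟩ := hpoint d
    exact ((isEmpty_of_isInitial initialIsInitial _).false (g a)).elim
  simp only [IsAufhebung, hl.isWayAbove_iff, le_iff_essImage, IsSubtoposOf,
    isNotNotSheaf_iff_essImage hpoint]
  constructor
  · exact fun h X => ⟨h.2 (pointsLevel D) h0 X, essImage_codiscrete_le h.1 hpoint X⟩
  · exact fun h => ⟨(h _).2 h0, fun n hn X hX => essImage_codiscrete_le hn hpoint X ((h X).1 hX)⟩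

end Level

end Levels

theorem mainTheorem10 (D : Type u) [SmallCategory D] [HasTerminal D]
    (hfact : HasSplitEpiMonoFactorizations D)
    (hpoint : ∀ d : D, Nonempty (⊤_ D ⟶ d)) :
    Nonempty (PreCohesive (Dᵒᵖ ⥤ Type u) (Type u)) ∧
    (∃ m : Level (Dᵒᵖ ⥤ Type u), m.IsSubtoposOf IsNotNotSheaf) ∧
    (∃ l : Level (Dᵒᵖ ⥤ Type u), l.IsMinusInfinity) ∧
    ∀ l : Level (Dᵒᵖ ⥤ Type u), l.IsMinusInfinity →
      ∀ m : Level (Dᵒᵖ ⥤ Type u),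
        (l.IsSuccessor m ↔ m.IsSubtoposOf IsNotNotSheaf) ∧
        (l.IsAufhebung m ↔ m.IsSubtoposOf IsNotNotSheaf) := by
  refine ⟨⟨preCohesivePresheaf hpoint⟩, ⟨pointsLevel D, pointsLevel_isSubtoposOf hpoint⟩,
    ⟨Level.minusInfinity _, Level.isMinusInfinity_minusInfinity⟩, fun l hl m => ?_⟩
  exact ⟨hl.isSuccessor_iff hpoint m, hl.isAufhebung_iff hpoint m⟩
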